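/- Let $(X_i,Y_i)_{i\ge 1}$ be an i.i.d. sequence of pairs of non-negative random variables on a probability space $(\Omega,\mathcal A,\mathbf P)$, with $X_1$ independent of $Y_1$. Let $F$ and $G$ be the cdf's of $X_1$ and $Y_1$, $\overline F=1-F$, $\overline G=1-G$. Assume that $F$ is continuous and that, for some constants $\gamma_1,\gamma_2,\beta_1,\beta_2,C_1,C_2>0$ and $D_1,D_2\in\mathbb R$, as $x\to\infty$, \[ \overline F(x)=C_1x^{-1/\gamma_1}\bigl(1+D_1x^{-\beta_1}(1+o(1))\bigr),\qquad \overline G(x)=C_2x^{-1/\gamma_2}\bigl(1+D_2x^{-\beta_2}(1+o(1))\bigr). \] Put $p=\gamma_2/(\gamma_1+\gamma_2)\in(0,1)$, $Z_i=\min(X_i,Y_i)$ and $\delta_i=\mathbf 1\{X_i\le Y_i\}$. For $n\ge1$ let $Z_{1:n}\le\dots\le Z_{n:n}$ be the order statistics of $Z_1,\dots,Z_n$, let $\delta_{(i)}$ be the indicator belonging to $Z_{i:n}$ (ties being broken by the order of the indices), and let \[ \overline F_n^{KM}(t)=\begin{cases}\displaystyle\prod_{i=1}^n\Bigl(1-\frac{\delta_{(i)}}{n-i+1}\Bigr)^{\mathbf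 1\{Z_{i:n}\le t\}},& t<Z_{n:n},\\ 0,& t\ge Z_{n:n},\end{cases} \] be the Kaplan--Meier estimator of $\overline F$. Let $k=k_n$ be a sequence of integers with $1<k<n$ for all large $n$, $k\to\infty$ and $k/n\to0$ as $n\to\infty$. Then \[ \max_{1\le j\le k}\left|\frac{\overline F_n^{KM}(Z_{n-j:n})}{\overline F_n^{KM}(Z_{n-k:n})}-\frac{\overline F_n^{KM}(Z_{n-j+1:n})}{\overline F_n^{KM}(Z_{n-k:n})}\right|=O_{\mathbf P}(k^{-p})\quad\text{as }n\to\infty, \] and in particular this maximum tends to $0$ in probability as $n\to\infty$. (If $Z_{n-k:n}=Z_{n:n}$, so that the denominator vanishes, the quotients are read as $0$.) -/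

import Mathlib

open Filter Topology MeasureTheory ProbabilityTheory

namespace CensoredTail

noncomputable section

/-- The tail (survival function) `1 - F` of the cdf `F` of a law `μ` on `ℝ`. -/
def tail (μ : Measure ℝ) (x : ℝ) : ℝ := 1 - cdf μ x

/-- Hall's second-order condition on a tail function `S`:
`S x = C x^(-1/γ) (1 + D x^(-β) (1 + o(1)))` as `x → ∞`. -/
def HallTail (S : ℝ → ℝ) (γ β C D : ℝ) : Prop :=
  ∃ ε : ℝ → ℝ, Tendsto ε atTop (𝓝 0) ∧
    ∀ᶠ x in atTop, S x = C * x ^ (-1 / γ) * (1 + D * x ^ (-β) * (1 + ε x))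

/-- The value of `v` at the index that has rank `i` (`1 ≤ i ≤ n`) when the sample `z` is sorted in
nondecreasing order. (Outside the range `1 ≤ i ≤ n` the value is `0` by convention.) -/
def concomitant {n : ℕ} (z v : Fin n → ℝ) (i : ℕ) : ℝ :=
  if h : 1 ≤ i ∧ i ≤ n then v (Tuple.sort z ⟨i - 1, by omega⟩) else 0

/-- The `i`-th order statistic `Z_{i:n}`, `1 ≤ i ≤ n`, of the sample `z`. -/
def orderStat {n : ℕ} (z : Fin n → ℝ) (i : ℕ) : ℝ := concomitant z z i

/-- The Kaplan-Meier estimator of the tail at the point `t`, from the observed sample `z` with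
non-censoring indicators `d`. -/
def kaplanMeier {n : ℕ} (z d : Fin n → ℝ) (t : ℝ) : ℝ :=
  if t < orderStat z n then
    ∏ i ∈ Finset.Icc 1 n,
      (1 - concomitant z d i / ((n : ℝ) - i + 1)) ^ (if orderStat z i ≤ t then 1 else 0)
  else 0

/-- The increment `S(Z_{n-j:n}) / S(Z_{n-k:n}) - S(Z_{n-j+1:n}) / S(Z_{n-k:n})` of the
Kaplan-Meier ratio, where `S` is the Kaplan-Meier estimator of the tail. -/
def kmIncrement {n : ℕ} (z d : Fin n → ℝ) (k j : ℕ) : ℝ :=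
  kaplanMeier z d (orderStat z (n - j)) / kaplanMeier z d (orderStat z (n - k)) -
    kaplanMeier z d (orderStat z (n - j + 1)) / kaplanMeier z d (orderStat z (n - k))

/-- The first `n` observed values `Z_i = min (X_i, Y_i)`. -/
def obs {Ω : Type*} (X Y : ℕ → Ω → ℝ) (n : ℕ) (ω : Ω) (i : Fin n) : ℝ := min (X i ω) (Y i ω)

open scoped Classical in
/-- The first `n` non-censoring indicators `δ_i = 1{X_i ≤ Y_i}`. -/
def uncens {Ω : Type*} (X Y : ℕ → Ω → ℝ) (n : ℕ) (ω : Ω) (i : Fin n) : ℝ :=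
  if X i ω ≤ Y i ω then 1 else 0

/-- The maximum over `1 ≤ j ≤ k` of the absolute Kaplan-Meier increments, computed from the
first `n` observations. -/
def maxIncrement {Ω : Type*} (X Y : ℕ → Ω → ℝ) (k n : ℕ) (ω : Ω) : ℝ :=
  ⨆ j : Fin k, |kmIncrement (obs X Y n ω) (uncens X Y n ω) k (j + 1)|

/-- `ξ n = O_P(a n)` as `n → ∞`. -/
def IsBigOInProbability {Ω : Type*} [MeasurableSpace Ω] (P : Measure Ω)
    (ξ : ℕ → Ω → ℝ) (a : ℕ → ℝ) : Prop :=
  ∀ η : ℝ, 0 < η → ∃ M : ℝ, 0 < M ∧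
    ∀ᶠ n in atTop, P {ω | M * |a n| < |ξ n ω|} ≤ ENNReal.ofReal η

end

end CensoredTail

/-!
The proof compares the Kaplan-Meier products at the top ranks with counts of observations above
fixed levels, and never uses a density of `F` or a quantile transform.

Write `D_l` for the non-censoring indicator of the `l`-th largest observation and
`R_j = ∏_{j < l ≤ k} (1 - D_l / l)`, which is the Kaplan-Meier ratio at `Z_{n-j:n}`. Since `F` is
continuous, uncensored observations are almost surely not tied with others (`ae_no_ties`), so this
product formula is right up to the jump to `0` at the maximum. The factors satisfy
`1 - D_l / l ≥ (l - 1) / l`, hence `R_j ≤ j R_1`. An increment `R_j D_j / j` is therefore at most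
`R_1`, and the jump to `0` is at most `m R_1`, where `m` is the number of observations tied at the
maximum (`abs_kmIncrement_le`). So everything reduces to `m = O_P(1)` and `R_1 = O_P(k ^ (-p))`.

As `R_1 ≤ exp (-∑_{2 ≤ l ≤ k} D_l / l)`, it remains to see that `∑_{l ≤ k} D_l / l` is at least
`p log k - O_P(1)`. By summation by parts (`le_sum_div_succ`) it is enough that the number `A_i`
of uncensored observations among the `i` largest is at least `p i - e_i` with
`∑_i e_i / (i (i + 1)) = O_P(1)`. Let `z_i` be a deterministic level exceeded with probability
about `i / n`. The `i` largest observations and the observations above `z_i` are nested sets, so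
`A_i` differs from the number of uncensored observations above `z_i` by at most `|i - N(z_i)|`,
where `N(z)` counts the observations above `z` (`sum_above_sub_le_sum_top`). Both counts are
binomial, with fluctuations `O(√i)`. An observation above `z` is uncensored with probability at
least `p - O(z ^ (-b))` (`eventually_prod_tail_bounds`, where the layer cake formula plays the role
of integration by parts in `∫_{x > z} x ^ (-1 / γ₂) dF(x)`), which gives a bias
`O(i (i / n) ^ c)`. Both bounds are summable against `1 / (i (i + 1))` (`sum_error_weights_le`), and
Markov's inequality finishes the estimate of `R_1`. The same counts bound `m`: for a large fixed
rank `L`, with high probability `1 ≤ N(z_L) < 2 L`, and then `m ≤ N(z_L)`.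
-/

namespace CensoredTail

/-! ### Order statistics and their concomitants -/

theorem concomitant_of_mem {n : ℕ} (z v : Fin n → ℝ) {i : ℕ} (h₁ : 1 ≤ i) (h₂ : i ≤ n) :
    concomitant z v i = v (Tuple.sort z ⟨i - 1, by omega⟩) :=
  dif_pos ⟨h₁, h₂⟩

theorem orderStat_le_orderStat {n : ℕ} (z : Fin n → ℝ) {i j : ℕ} (hi : 1 ≤ i) (hij : i ≤ j)
    (hj : j ≤ n) : orderStat z i ≤ orderStat z j := by
  rw [orderStat, orderStat, concomitant_of_mem z z hi (hij.trans hj),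
    concomitant_of_mem z z (hi.trans hij) hj]
  exact Tuple.monotone_sort z (Fin.mk_le_mk.2 (by omega))

theorem concomitant_nonneg {n : ℕ} (z : Fin n → ℝ) {v : Fin n → ℝ} (hv : ∀ x, 0 ≤ v x) (i : ℕ) :
    0 ≤ concomitant z v i := by
  unfold concomitant
  split_ifs
  exacts [hv _, le_rfl]

theorem concomitant_le_one {n : ℕ} (z : Fin n → ℝ) {v : Fin n → ℝ} (hv : ∀ x, v x ≤ 1) (i : ℕ) :
    concomitant z v i ≤ 1 := by
  unfold concomitant
  split_ifs
  exacts [hv _, zero_le_one]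

/-- Summing over the sample is the same as summing over the ranks, counted from the top. -/
theorem sum_eq_sum_concomitant {n : ℕ} (z g : Fin n → ℝ) :
    ∑ x, g x = ∑ l ∈ Finset.range n, concomitant z g (n - l) := by
  rw [Finset.sum_range, ← Equiv.sum_comp (Fin.revPerm.trans (Tuple.sort z)) g]
  refine Finset.sum_congr rfl fun x _ => ?_
  rw [concomitant_of_mem z g (by omega) (by omega)]
  rw [show (⟨n - x - 1, by omega⟩ : Fin n) = x.rev from
    Fin.ext (by rw [Fin.val_rev]; simp only; omega)]
  rfl

/-- The `i` largest observations and the observations above `t` are nested sets, so they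
differ by exactly `|i - #{z > t}|` elements. Hence the total weight of the former is at least that
of the latter up to this number. -/
theorem sum_above_sub_le_sum_top {n : ℕ} (z : Fin n → ℝ) {d : Fin n → ℝ} (hd₀ : ∀ x, 0 ≤ d x)
    (hd₁ : ∀ x, d x ≤ 1) (t : ℝ) {i : ℕ} (hi : i ≤ n) :
    (∑ x, if t < z x then d x else 0) - |(i : ℝ) - ∑ x, if t < z x then 1 else 0| ≤
      ∑ l ∈ Finset.range i, concomitant z d (n - l) := by
  have hrank : ∀ v : Fin n → ℝ, (∑ x, if t < z x then v x else 0) =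
      ∑ l ∈ Finset.range n, if t < orderStat z (n - l) then concomitant z v (n - l) else 0 := by
    intro v
    rw [sum_eq_sum_concomitant z]
    refine Finset.sum_congr rfl fun l hl => ?_
    have hl := Finset.mem_range.1 hl
    rw [orderStat, concomitant_of_mem _ _ (by omega) (by omega),
      concomitant_of_mem _ _ (by omega) (by omega), concomitant_of_mem _ _ (by omega) (by omega)]
  have hone : (∑ x, if t < z x then (1 : ℝ) else 0) =
      ∑ l ∈ Finset.range n, if t < orderStat z (n - l) then 1 else 0 := by
    rw [hrank fun _ => 1]
    refine Finset.sum_congr rfl fun l hl => ?_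
    have hl := Finset.mem_range.1 hl
    rw [concomitant_of_mem z (fun _ => (1 : ℝ)) (by omega) (by omega)]
  rw [hrank, hone, ← Finset.sum_range_add_sum_Ico _ hi, ← Finset.sum_range_add_sum_Ico _ hi]
  by_cases h : ∃ l₀, i ≤ l₀ ∧ l₀ < n ∧ t < orderStat z (n - l₀)
  · obtain ⟨l₀, hl₀, hl₀n, ht⟩ := h
    have hall : ∀ l ∈ Finset.range i, t < orderStat z (n - l) := fun l hl =>
      ht.trans_le (orderStat_le_orderStat z (by omega)
        (by have := Finset.mem_range.1 hl; omega) (by omega))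
    rw [Finset.sum_congr rfl fun l hl => if_pos (hall l hl),
      Finset.sum_congr (f := fun l => if t < orderStat z (n - l) then (1 : ℝ) else 0)
        (g := fun _ => 1) rfl fun l hl => if_pos (hall l hl)]
    have hle : (∑ l ∈ Finset.Ico i n,
          if t < orderStat z (n - l) then concomitant z d (n - l) else 0) ≤
        ∑ l ∈ Finset.Ico i n, if t < orderStat z (n - l) then (1 : ℝ) else 0 := by
      refine Finset.sum_le_sum fun l _ => ?_
      split_ifs
      exacts [concomitant_le_one z hd₁ _, le_rfl]
    simp only [Finset.sum_const, Finset.card_range, nsmul_eq_mul, mul_one]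
    have := neg_abs_le ((i : ℝ) - (i + ∑ l ∈ Finset.Ico i n,
      if t < orderStat z (n - l) then (1 : ℝ) else 0))
    linarith
  · push Not at h
    have hzero : (∑ l ∈ Finset.Ico i n,
        if t < orderStat z (n - l) then concomitant z d (n - l) else 0) = 0 :=
      Finset.sum_eq_zero fun l hl => if_neg
        (h l (Finset.mem_Ico.1 hl).1 (Finset.mem_Ico.1 hl).2).not_gt
    have hle : (∑ l ∈ Finset.range i,
          if t < orderStat z (n - l) then concomitant z d (n - l) else 0) ≤
        ∑ l ∈ Finset.range i, concomitant z d (n - l) := by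
      refine Finset.sum_le_sum fun l _ => ?_
      split_ifs
      exacts [le_rfl, concomitant_nonneg z hd₀ _]
    rw [hzero]
    linarith [abs_nonneg ((i : ℝ) - ((∑ l ∈ Finset.range i,
      if t < orderStat z (n - l) then (1 : ℝ) else 0) + ∑ l ∈ Finset.Ico i n,
      if t < orderStat z (n - l) then (1 : ℝ) else 0))]

/-- If the `j` largest observations exceed `t`, then at least `j` observations do. -/
theorem le_sum_above {n : ℕ} (z : Fin n → ℝ) {t : ℝ} {j : ℕ} (hj : j ≤ n)
    (h : 1 ≤ j → t < orderStat z (n - j + 1)) :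
    (j : ℝ) ≤ ∑ x, if t < z x then 1 else 0 := by
  rw [sum_eq_sum_concomitant z, ← Finset.sum_range_add_sum_Ico _ hj]
  have h₁ : ∑ l ∈ Finset.range j, concomitant z (fun x => if t < z x then (1 : ℝ) else 0) (n - l) =
      j := by
    rw [Finset.sum_congr rfl (g := fun _ => (1 : ℝ))]
    · simp
    · intro l hl
      have hl := Finset.mem_range.1 hl
      have hlt := (h (by omega)).trans_le
        (orderStat_le_orderStat z (by omega) (show n - j + 1 ≤ n - l by omega) (by omega))
      rw [orderStat, concomitant_of_mem _ _ (by omega) (by omega)] at hlt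
      rw [concomitant_of_mem _ _ (by omega) (by omega), if_pos hlt]
  have h₂ : 0 ≤ ∑ l ∈ Finset.Ico j n,
      concomitant z (fun x => if t < z x then (1 : ℝ) else 0) (n - l) :=
    Finset.sum_nonneg fun l _ => concomitant_nonneg z (fun x => by split_ifs <;> norm_num) _
  linarith

/-! ### The Kaplan-Meier product along the order statistics -/

/-- The product of the first `n - j` Kaplan-Meier factors. Without ties this is the
Kaplan-Meier estimator at `Z_{n-j:n}`, for `1 ≤ j`. -/
noncomputable def kmProd {n : ℕ} (z d : Fin n → ℝ) (j : ℕ) : ℝ :=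
  ∏ l ∈ Finset.Icc 1 (n - j), (1 - concomitant z d l / ((n : ℝ) - l + 1))

/-- Tied observations are harmless as long as they are censored, because their factors are `1`. -/
theorem kaplanMeier_orderStat {n : ℕ} {z d : Fin n → ℝ}
    (hties : ∀ x y, x ≠ y → z x = z y → d x = 0) {j : ℕ} (hj : j < n) :
    kaplanMeier z d (orderStat z (n - j)) =
      if orderStat z (n - j) < orderStat z n then kmProd z d j else 0 := by
  unfold kaplanMeier kmProd
  refine if_congr Iff.rfl ?_ rfl
  rw [← Finset.prod_subset (Finset.Icc_subset_Icc_right (Nat.sub_le n j))]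
  · refine Finset.prod_congr rfl fun l hl => ?_
    have hl := Finset.mem_Icc.1 hl
    rw [if_pos (orderStat_le_orderStat z hl.1 hl.2 (Nat.sub_le n j)), pow_one]
  · intro l hl hl'
    simp only [Finset.mem_Icc, not_and, not_le] at hl hl'
    have hlt := hl' hl.1
    split_ifs with hle
    · have heq := le_antisymm hle (orderStat_le_orderStat z (by omega) hlt.le hl.2)
      rw [orderStat, orderStat, concomitant_of_mem _ _ hl.1 hl.2,
        concomitant_of_mem _ _ (by omega) (by omega)] at heq
      rw [concomitant_of_mem _ _ hl.1 hl.2, hties _ _ _ heq]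
      · simp
      · intro h
        have := congrArg Fin.val ((Tuple.sort z).injective h)
        simp only at this
        omega
    · simp

theorem kmProd_pos {n : ℕ} (z : Fin n → ℝ) {d : Fin n → ℝ} (hd₁ : ∀ x, d x ≤ 1) {j : ℕ}
    (hj : 1 ≤ j) : 0 < kmProd z d j := by
  refine Finset.prod_pos fun l hl => ?_
  have hl := Finset.mem_Icc.1 hl
  have h : (l : ℝ) + 1 ≤ n := by exact_mod_cast (show l + 1 ≤ n by omega)
  rw [sub_pos, div_lt_one (by linarith)]
  linarith [concomitant_le_one z hd₁ l]

theorem kmProd_eq_kmProd_succ_mul {n : ℕ} (z d : Fin n → ℝ) {j : ℕ} (hj : j < n) :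
    kmProd z d j = kmProd z d (j + 1) * (1 - concomitant z d (n - j) / ((j : ℝ) + 1)) := by
  unfold kmProd
  have h : n - j = n - (j + 1) + 1 := by omega
  rw [h, Finset.prod_Icc_succ_top (by omega), ← h, Nat.cast_sub hj.le]
  ring_nf

/-- The ratio of Kaplan-Meier products is at most linear: `Q_j / j` is nonincreasing in `j`. -/
theorem kmProd_le_mul {n : ℕ} (z : Fin n → ℝ) {d : Fin n → ℝ} (hd₁ : ∀ x, d x ≤ 1) {j : ℕ}
    (hj : 1 ≤ j) (hjn : j ≤ n) : kmProd z d j ≤ j * kmProd z d 1 := by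
  induction j, hj using Nat.le_induction with
  | base => simp
  | succ j hj ih =>
    have ih := ih (by omega)
    have hpos := kmProd_pos z hd₁ (show 1 ≤ j + 1 by omega)
    have hc := concomitant_le_one z hd₁ (n - j)
    rw [kmProd_eq_kmProd_succ_mul z d (show j < n by omega)] at ih
    have hj0 : (0 : ℝ) < j := by exact_mod_cast hj
    have h1 : (j : ℝ) / (j + 1) ≤ 1 - concomitant z d (n - j) / ((j : ℝ) + 1) := by
      rw [div_le_iff₀ (by positivity), sub_mul, div_mul_cancel₀ _ (by positivity)]
      linarith
    have h2 := (mul_le_mul_of_nonneg_left h1 hpos.le).trans ih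
    rw [mul_div_assoc', div_le_iff₀ (by positivity)] at h2
    push_cast
    nlinarith

theorem kmProd_one_le {n : ℕ} (z : Fin n → ℝ) {d : Fin n → ℝ} (hd₁ : ∀ x, d x ≤ 1) {k : ℕ}
    (hk : 1 ≤ k) (hkn : k ≤ n) :
    kmProd z d 1 ≤ kmProd z d k *
      Real.exp (-∑ l ∈ Finset.Ico 1 k, concomitant z d (n - l) / ((l : ℝ) + 1)) := by
  induction k, hk using Nat.le_induction with
  | base => simp
  | succ k hk ih =>
    refine (ih (by omega)).trans ?_
    rw [Finset.sum_Ico_succ_top hk, neg_add, Real.exp_add,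
      kmProd_eq_kmProd_succ_mul z d (show k < n by omega), mul_assoc, mul_comm (Real.exp _)]
    refine mul_le_mul_of_nonneg_left (mul_le_mul_of_nonneg_right ?_ (Real.exp_pos _).le)
      (kmProd_pos z hd₁ (by omega)).le
    linarith [Real.add_one_le_exp (-(concomitant z d (n - k) / ((k : ℝ) + 1)))]

/-- All increments are bounded by the value of the Kaplan-Meier ratio one step before the last
observation, up to the number of observations that may be tied with the largest one. That
number is controlled by counting the observations above any level `t` below the maximum. -/
theorem abs_kmIncrement_le {n : ℕ} {z d : Fin n → ℝ} (hd₀ : ∀ x, 0 ≤ d x) (hd₁ : ∀ x, d x ≤ 1)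
    (hties : ∀ x y, x ≠ y → z x = z y → d x = 0) {t M : ℝ}
    (ht : 1 ≤ ∑ x, if t < z x then (1 : ℝ) else 0) (hM : (∑ x, if t < z x then (1 : ℝ) else 0) ≤ M)
    {k j : ℕ} (hkn : k < n) (hj : 1 ≤ j) (hjk : j ≤ k) :
    |kmIncrement z d k j| ≤ M * (kmProd z d 1 / kmProd z d k) := by
  obtain ⟨i, rfl⟩ : ∃ i, j = i + 1 := ⟨j - 1, by omega⟩
  have hM1 : 1 ≤ M := ht.trans hM
  have hQ1 := kmProd_pos z hd₁ le_rfl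
  have hQk := kmProd_pos z hd₁ (hj.trans hjk)
  have hRHS : 0 ≤ M * (kmProd z d 1 / kmProd z d k) := by positivity
  unfold kmIncrement
  rw [show n - (i + 1) + 1 = n - i by omega, kaplanMeier_orderStat hties (j := i + 1) (by omega),
    kaplanMeier_orderStat hties (j := k) hkn, kaplanMeier_orderStat hties (j := i) (by omega)]
  by_cases hk : orderStat z (n - k) < orderStat z n
  swap
  · simpa [hk] using hRHS
  rw [if_pos hk, ← sub_div, abs_div, abs_of_pos hQk, mul_div_assoc']
  refine div_le_div_of_nonneg_right ?_ hQk.le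
  have hQj := kmProd_le_mul z hd₁ hj (hjk.trans hkn.le)
  have hQj0 := kmProd_pos z hd₁ hj
  by_cases hi : orderStat z (n - i) < orderStat z n
  · have hi' : orderStat z (n - (i + 1)) < orderStat z n :=
      (orderStat_le_orderStat z (by omega) (by omega) (by omega)).trans_lt hi
    rw [if_pos hi, if_pos hi', kmProd_eq_kmProd_succ_mul z d (show i < n by omega)]
    have hc₀ := concomitant_nonneg z hd₀ (n - i)
    have hc₁ := concomitant_le_one z hd₁ (n - i)
    have h1 : kmProd z d (i + 1) - kmProd z d (i + 1) * (1 - concomitant z d (n - i) / (i + 1)) =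
        kmProd z d (i + 1) / (i + 1) * concomitant z d (n - i) := by ring
    rw [h1, abs_of_nonneg (by positivity)]
    have h2 : kmProd z d (i + 1) / (i + 1) ≤ kmProd z d 1 := by
      rw [div_le_iff₀ (by positivity)]
      push_cast at hQj
      linarith
    have h3 : 0 ≤ kmProd z d (i + 1) / (i + 1) := by positivity
    nlinarith
  · rw [if_neg hi, sub_zero]
    split_ifs with hi'
    · rw [abs_of_pos hQj0]
      -- the top `i + 1` observations are tied at the maximum, which exceeds `t`
      have htop : t < orderStat z n := by
        by_contra hcon
        have h0 : (∑ x, if t < z x then (1 : ℝ) else 0) = 0 := by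
          refine Finset.sum_eq_zero fun x _ => if_neg ?_
          have hx : z x = orderStat z ((Tuple.sort z).symm x + 1) := by
            rw [orderStat, concomitant_of_mem _ _ (by omega) (by omega)]
            simp
          rw [hx]
          exact not_lt.2 ((orderStat_le_orderStat z (by omega) (by omega) le_rfl).trans
            (not_lt.1 hcon))
        linarith
      have hcard := le_sum_above z (t := t) (j := i + 1) (by omega) fun _ => by
        rw [show n - (i + 1) + 1 = n - i by omega]
        exact htop.trans_le (not_lt.1 hi)
      exact hQj.trans (mul_le_mul_of_nonneg_right (hcard.trans hM) hQ1.le)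
    · simp only [abs_zero]
      positivity

/-! ### Summation by parts -/

theorem sum_div_succ_eq (w : ℕ → ℝ) (k : ℕ) :
    ∑ l ∈ Finset.range k, w l / ((l : ℝ) + 1) =
      (∑ l ∈ Finset.range k, w l) / ((k : ℝ) + 1) +
        ∑ i ∈ Finset.range k, (∑ l ∈ Finset.range (i + 1), w l) / (((i : ℝ) + 1) * (i + 2)) := by
  induction k with
  | zero => simp
  | succ k ih =>
    rw [Finset.sum_range_succ, ih, Finset.sum_range_succ (fun i : ℕ =>
      (∑ l ∈ Finset.range (i + 1), w l) / (((i : ℝ) + 1) * (i + 2))), Finset.sum_range_succ w]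
    have h1 : (k : ℝ) + 1 ≠ 0 := by positivity
    have h2 : (k : ℝ) + 2 ≠ 0 := by positivity
    have h3 : (k : ℝ) + 1 + 1 ≠ 0 := by positivity
    push_cast
    field_simp
    ring

/-- If the partial sums of `w` are at least `p i - e i`, then the harmonic sum of `w` is
at least `p log k`, up to a weighted sum of the errors `e`. -/
theorem le_sum_div_succ {w e : ℕ → ℝ} {p : ℝ} (hp : 0 ≤ p) {k : ℕ} (hk : 1 ≤ k)
    (h : ∀ i, 1 ≤ i → i ≤ k → p * i - e i ≤ ∑ l ∈ Finset.range i, w l) :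
    p * Real.log k - e k / ((k : ℝ) + 1) -
        ∑ i ∈ Finset.range k, e (i + 1) / (((i : ℝ) + 1) * (i + 2)) ≤
      ∑ l ∈ Finset.range k, w l / ((l : ℝ) + 1) := by
  have hlog : Real.log k ≤ ∑ l ∈ Finset.range k, 1 / ((l : ℝ) + 1) := by
    have h1 := log_add_one_le_harmonic k
    have h2 : Real.log k ≤ Real.log ((k : ℝ) + 1) :=
      Real.log_le_log (by exact_mod_cast hk) (by linarith)
    simp only [harmonic, Rat.cast_sum, Rat.cast_inv, Rat.cast_natCast] at h1
    push_cast at h1 h2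
    simp only [one_div]
    linarith
  have habel := sum_div_succ_eq (fun l => w l - p) k
  simp only [sub_div, Finset.sum_sub_distrib, Finset.sum_const, Finset.card_range,
    nsmul_eq_mul] at habel
  have hlast : -(e k / ((k : ℝ) + 1)) ≤
      (∑ l ∈ Finset.range k, w l) / ((k : ℝ) + 1) - k * p / ((k : ℝ) + 1) := by
    rw [← sub_div, ← neg_div]
    exact div_le_div_of_nonneg_right (by linarith [h k hk le_rfl]) (by positivity)
  have hsum : -∑ i ∈ Finset.range k, e (i + 1) / (((i : ℝ) + 1) * (i + 2)) ≤
      ∑ i ∈ Finset.range k, (∑ l ∈ Finset.range (i + 1), w l) / (((i : ℝ) + 1) * (i + 2)) -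
        ∑ i ∈ Finset.range k, (((i + 1 : ℕ) : ℝ) * p) / (((i : ℝ) + 1) * (i + 2)) := by
    rw [← Finset.sum_neg_distrib, ← Finset.sum_sub_distrib]
    refine Finset.sum_le_sum fun i hi => ?_
    rw [← sub_div, ← neg_div]
    have := h (i + 1) (by omega) (by have := Finset.mem_range.1 hi; omega)
    exact div_le_div_of_nonneg_right (by linarith) (by positivity)
  have hpl := mul_le_mul_of_nonneg_left hlog hp
  rw [Finset.mul_sum] at hpl
  simp only [mul_one_div] at hpl
  linarith

/-! ### Tails of the observed values and of the uncensored observed values -/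

theorem HallTail.exists_abs_sub_le {S : ℝ → ℝ} {γ β C D : ℝ} (h : HallTail S γ β C D) {b : ℝ}
    (hb : b ≤ β) :
    ∃ K, 0 < K ∧ ∀ᶠ x in atTop, |S x - C * x ^ (-1 / γ)| ≤ K * x ^ (-1 / γ) * x ^ (-b) := by
  obtain ⟨ε, hε, hS⟩ := h
  refine ⟨2 * |C| * |D| + 1, by positivity, ?_⟩
  have hε1 : ∀ᶠ x in atTop, |ε x| < 1 := by
    simpa using (tendsto_order.1 hε.abs).2 1 (by simp)
  filter_upwards [hε1, hS, eventually_ge_atTop 1] with x h1 hx hx1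
  have hx0 : 0 < x := by linarith
  have hpa : 0 < x ^ (-1 / γ) := Real.rpow_pos_of_pos hx0 _
  have hpb : 0 < x ^ (-β) := Real.rpow_pos_of_pos hx0 _
  have hle : x ^ (-β) ≤ x ^ (-b) := Real.rpow_le_rpow_of_exponent_le hx1 (by linarith)
  have h2 : |1 + ε x| ≤ 2 := by
    rw [abs_lt] at h1
    rw [abs_le]
    constructor <;> linarith
  rw [hx, show C * x ^ (-1 / γ) * (1 + D * x ^ (-β) * (1 + ε x)) - C * x ^ (-1 / γ) =
    C * x ^ (-1 / γ) * (D * x ^ (-β) * (1 + ε x)) by ring, abs_mul, abs_mul, abs_mul, abs_mul,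
    abs_of_pos hpa, abs_of_pos hpb]
  calc |C| * x ^ (-1 / γ) * (|D| * x ^ (-β) * |1 + ε x|)
      ≤ |C| * x ^ (-1 / γ) * (|D| * x ^ (-b) * 2) := by gcongr
    _ = (2 * |C| * |D|) * x ^ (-1 / γ) * x ^ (-b) := by ring
    _ ≤ (2 * |C| * |D| + 1) * x ^ (-1 / γ) * x ^ (-b) := by gcongr; linarith

theorem tail_eq_measureReal_Ioi (μ : Measure ℝ) [IsProbabilityMeasure μ] (x : ℝ) :
    tail μ x = μ.real (Set.Ioi x) := by
  rw [tail, cdf_eq_real, ← Set.compl_Iic, probReal_compl_eq_one_sub measurableSet_Iic]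

theorem nullSingletonClass_of_continuous_cdf (μ : Measure ℝ) [IsProbabilityMeasure μ]
    (h : Continuous (cdf μ)) : NullSingletonClass μ := by
  refine ⟨fun x => ?_⟩
  rw [← measure_cdf μ, StieltjesFunction.measure_singleton,
    h.continuousWithinAt.leftLim_eq, sub_self, ENNReal.ofReal_zero]

/-- A lower bound for `∫_{(z,∞)} x ^ (-a) dF(x)` by the layer cake formula: it is what integration
by parts gives when the tail of `F` is replaced by its upper bound `B y ^ (-b)`. -/
theorem le_setIntegral_rpow_neg (μ : Measure ℝ) [IsProbabilityMeasure μ] [NullSingletonClass μ]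
    {a b z B : ℝ} (ha : 0 < a) (hb : 0 < b) (hz : 0 < z)
    (hB : ∀ y, z ≤ y → μ.real (Set.Ioi y) ≤ B * y ^ (-b)) :
    z ^ (-a) * μ.real (Set.Ioi z) - B * (z ^ (-a) * z ^ (-b)) * (a / (a + b)) ≤
      ∫ x in Set.Ioi z, x ^ (-a) ∂μ := by
  have hM : 0 < z ^ (-a) := Real.rpow_pos_of_pos hz _
  have hbd : ∀ x ∈ Set.Ioi z, x ^ (-a) ≤ z ^ (-a) := fun x hx =>
    Real.rpow_le_rpow_of_nonpos hz (le_of_lt hx) (by linarith)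
  have hnn : ∀ x ∈ Set.Ioi z, 0 ≤ x ^ (-a) := fun x hx => Real.rpow_nonneg (hz.trans hx).le _
  have hint : Integrable (fun x : ℝ => x ^ (-a)) (μ.restrict (Set.Ioi z)) := by
    refine Measure.integrableOn_of_bounded (M := z ^ (-a)) (measure_ne_top _ _)
      (by fun_prop) ?_
    filter_upwards [ae_restrict_mem measurableSet_Ioi] with x hx
    rw [Real.norm_of_nonneg (hnn x hx)]
    exact hbd x hx
  rw [hint.integral_eq_integral_Ioc_meas_le
    (by filter_upwards [ae_restrict_mem measurableSet_Ioi] with x hx using hnn x hx)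
    (by filter_upwards [ae_restrict_mem measurableSet_Ioi] with x hx using hbd x hx),
    ← intervalIntegral.integral_of_le hM.le]
  have hanti : Antitone fun t : ℝ => (μ.restrict (Set.Ioi z)).real {x | t ≤ x ^ (-a)} :=
    fun s t hst => measureReal_mono fun x (hx : t ≤ x ^ (-a)) => hst.trans hx
  have hba : 0 < b / a := by positivity
  have hcalc : ∫ t in (0 : ℝ)..z ^ (-a), (μ.real (Set.Ioi z) - B * t ^ (b / a)) =
      z ^ (-a) * μ.real (Set.Ioi z) - B * (z ^ (-a) * z ^ (-b)) * (a / (a + b)) := by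
    rw [intervalIntegral.integral_sub (by simp)
      ((intervalIntegral.intervalIntegrable_rpow' (by linarith)).const_mul B),
      intervalIntegral.integral_const, intervalIntegral.integral_const_mul,
      integral_rpow (Or.inl (by linarith)), Real.zero_rpow (by positivity), ← Real.rpow_mul hz.le,
      ← Real.rpow_add hz, show -a * (b / a + 1) = -a + -b by field_simp; ring]
    simp only [sub_zero, smul_eq_mul]
    have : b / a + 1 = (a + b) / a := by field_simp; ring
    rw [this]
    field_simp
  rw [← hcalc]
  refine intervalIntegral.integral_mono_on hM.le ?_ hanti.intervalIntegrable ?_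
  · exact (by simp : IntervalIntegrable (fun _ : ℝ => μ.real (Set.Ioi z)) volume 0 _).sub
      ((intervalIntegral.intervalIntegrable_rpow' (by linarith)).const_mul B)
  intro t ht
  rcases ht.1.eq_or_lt with rfl | ht0
  · rw [Real.zero_rpow hba.ne', mul_zero, sub_zero, measureReal_restrict_apply' measurableSet_Ioi]
    exact measureReal_mono fun x hx => ⟨hnn x hx, hx⟩
  -- the level `y` at which `y ^ (-a) = t`
  set y := t ^ (-1 / a) with hy
  have hy0 : 0 < y := Real.rpow_pos_of_pos ht0 _
  have hya : y ^ (-a) = t := by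
    rw [hy, ← Real.rpow_mul ht0.le, show -1 / a * -a = 1 by field_simp, Real.rpow_one]
  have hyb : y ^ (-b) = t ^ (b / a) := by
    rw [hy, ← Real.rpow_mul ht0.le]
    congr 1
    field_simp
  have hzy : z ≤ y := by
    by_contra hlt
    have := Real.rpow_lt_rpow_of_neg hy0 (not_le.1 hlt) (show -a < 0 by linarith)
    rw [hya] at this
    exact absurd ht.2 this.not_ge
  rw [measureReal_restrict_apply' measurableSet_Ioi, ← hyb]
  have hsub : Set.Ioi z ⊆ ({x | t ≤ x ^ (-a)} ∩ Set.Ioi z) ∪ Set.Ici y := by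
    intro x hx
    rcases le_or_gt y x with h | h
    · exact Or.inr h
    · refine Or.inl ⟨?_, hx⟩
      rw [Set.mem_ofPred_eq, ← hya]
      exact Real.rpow_le_rpow_of_nonpos (hz.trans hx) h.le (by linarith)
  have h1 := (measureReal_mono (μ := μ) hsub).trans (measureReal_union_le _ _)
  have h2 : μ.real (Set.Ici y) = μ.real (Set.Ioi y) := measureReal_congr Ioi_ae_eq_Ici.symm
  have h3 := hB y hzy
  linarith

/-- The pairs whose observed value exceeds `z`. -/
def aboveSet (z : ℝ) : Set (ℝ × ℝ) := {q | z < min q.1 q.2}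

/-- The pairs whose observed value exceeds `z` and is not censored. -/
def uncensSet (z : ℝ) : Set (ℝ × ℝ) := {q | z < min q.1 q.2 ∧ q.1 ≤ q.2}

theorem measurableSet_aboveSet (z : ℝ) : MeasurableSet (aboveSet z) :=
  measurableSet_lt measurable_const (measurable_fst.min measurable_snd)

theorem measurableSet_uncensSet (z : ℝ) : MeasurableSet (uncensSet z) :=
  (measurableSet_aboveSet z).inter (measurableSet_le measurable_fst measurable_snd)

theorem uncensSet_subset (z : ℝ) : uncensSet z ⊆ aboveSet z := fun _ h => h.1

theorem measureReal_prod_aboveSet (μ ν : Measure ℝ) [IsProbabilityMeasure μ]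
    [IsProbabilityMeasure ν] (z : ℝ) :
    (μ.prod ν).real (aboveSet z) = μ.real (Set.Ioi z) * ν.real (Set.Ioi z) := by
  rw [← measureReal_prod_prod]
  congr 1
  ext q
  simp [aboveSet]

theorem le_measureReal_prod_uncensSet (μ ν : Measure ℝ) [IsProbabilityMeasure μ]
    [IsProbabilityMeasure ν] {z a A : ℝ} (hz : 0 < z) (ha : 0 < a)
    (hA : ∀ y, z ≤ y → A * y ^ (-a) ≤ ν.real (Set.Ioi y)) :
    A * ∫ x in Set.Ioi z, x ^ (-a) ∂μ ≤ (μ.prod ν).real (uncensSet z) := by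
  rw [measureReal_def, Measure.prod_apply (measurableSet_uncensSet z), ← integral_toReal]
  rotate_left
  · exact (measurable_measure_prodMk_left (measurableSet_uncensSet z)).aemeasurable
  · exact Eventually.of_forall fun x => measure_lt_top _ _
  rw [← integral_const_mul, ← integral_indicator measurableSet_Ioi]
  refine integral_mono ?_ ?_ fun x => ?_
  · rw [integrable_indicator_iff measurableSet_Ioi]
    refine Integrable.const_mul ?_ A
    refine Measure.integrableOn_of_bounded (M := z ^ (-a)) (measure_ne_top _ _)
      (by fun_prop) ?_
    filter_upwards [ae_restrict_mem measurableSet_Ioi] with x hx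
    rw [Real.norm_of_nonneg (Real.rpow_nonneg (hz.trans hx).le _)]
    exact Real.rpow_le_rpow_of_nonpos hz (le_of_lt hx) (by linarith)
  · refine Integrable.of_bound (C := 1)
      (measurable_measure_prodMk_left
        (measurableSet_uncensSet z)).ennreal_toReal.aestronglyMeasurable
      (Eventually.of_forall fun x => ?_)
    rw [Real.norm_of_nonneg ENNReal.toReal_nonneg]
    exact measureReal_le_one
  · by_cases hx : x ∈ Set.Ioi z
    · rw [Set.indicator_of_mem hx]
      refine (hA x (le_of_lt hx)).trans (measureReal_mono ?_)
      intro y hy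
      exact ⟨lt_min hx ((Set.mem_Ioi.1 hx).trans hy), le_of_lt hy⟩
    · rw [Set.indicator_of_notMem hx]
      exact ENNReal.toReal_nonneg

/-- With `p = a₁ / (a₁ + a₂)`, an observation above a high level `z` is uncensored with
probability at least `p`, up to a relative error of polynomial order `z ^ (-b)`. -/
theorem eventually_prod_tail_bounds (μ ν : Measure ℝ) [IsProbabilityMeasure μ]
    [IsProbabilityMeasure ν] [NullSingletonClass μ] {a₁ a₂ b C₁ C₂ K₁ K₂ : ℝ}
    (ha₁ : 0 < a₁) (ha₂ : 0 < a₂) (hb : 0 < b) (hC₁ : 0 < C₁) (hC₂ : 0 < C₂) (hK₁ : 0 < K₁) (hK₂ : 0 < K₂)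
    (h₁ : ∀ᶠ x in atTop, |μ.real (Set.Ioi x) - C₁ * x ^ (-a₁)| ≤ K₁ * x ^ (-a₁) * x ^ (-b))
    (h₂ : ∀ᶠ x in atTop, |ν.real (Set.Ioi x) - C₂ * x ^ (-a₂)| ≤ K₂ * x ^ (-a₂) * x ^ (-b)) :
    ∃ K, 0 < K ∧ ∀ᶠ z in atTop,
      |(μ.prod ν).real (aboveSet z) - C₁ * C₂ * z ^ (-(a₁ + a₂))| ≤
        K * z ^ (-(a₁ + a₂)) * z ^ (-b) ∧
      a₁ / (a₁ + a₂) * (C₁ * C₂ * z ^ (-(a₁ + a₂))) - K * z ^ (-(a₁ + a₂)) * z ^ (-b) ≤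
        (μ.prod ν).real (uncensSet z) := by
  refine ⟨C₁ * K₂ + 2 * (C₂ * K₁) + K₁ * K₂, by positivity, ?_⟩
  have hsmall : ∀ᶠ z : ℝ in atTop, K₂ * z ^ (-b) < C₂ := by
    have := (tendsto_rpow_neg_atTop hb).const_mul K₂
    rw [mul_zero] at this
    exact (tendsto_order.1 this).2 _ hC₂
  obtain ⟨x₁, hx₁⟩ := eventually_atTop.1 h₁
  obtain ⟨x₂, hx₂⟩ := eventually_atTop.1 h₂
  filter_upwards [eventually_ge_atTop x₁, eventually_ge_atTop x₂, eventually_ge_atTop 1, hsmall]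
    with z hz₁ hz₂ hz hs
  have hz0 : 0 < z := by linarith
  have e₁ := abs_le.1 (hx₁ z hz₁)
  have e₂ := abs_le.1 (hx₂ z hz₂)
  have hzb1 : z ^ (-b) ≤ 1 := Real.rpow_le_one_of_one_le_of_nonpos hz (by linarith)
  have hanti : ∀ y, z ≤ y → y ^ (-b) ≤ z ^ (-b) := fun y hy =>
    Real.rpow_le_rpow_of_nonpos hz0 hy (by linarith)
  have hB : ∀ y, z ≤ y → μ.real (Set.Ioi y) ≤ (C₁ + K₁ * z ^ (-b)) * y ^ (-a₁) := by
    intro y hy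
    have h := abs_le.1 (hx₁ y (hz₁.trans hy))
    have hp : 0 < K₁ * y ^ (-a₁) := mul_pos hK₁ (Real.rpow_pos_of_pos (hz0.trans_le hy) _)
    have := mul_le_mul_of_nonneg_left (hanti y hy) hp.le
    linarith
  have hA : ∀ y, z ≤ y → (C₂ - K₂ * z ^ (-b)) * y ^ (-a₂) ≤ ν.real (Set.Ioi y) := by
    intro y hy
    have h := abs_le.1 (hx₂ y (hz₂.trans hy))
    have hp : 0 < K₂ * y ^ (-a₂) := mul_pos hK₂ (Real.rpow_pos_of_pos (hz0.trans_le hy) _)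
    have := mul_le_mul_of_nonneg_left (hanti y hy) hp.le
    linarith
  have hI := le_setIntegral_rpow_neg μ ha₂ ha₁ hz0 hB
  have hU := le_measureReal_prod_uncensSet μ ν hz0 ha₂ hA
  rw [measureReal_prod_aboveSet, neg_add, Real.rpow_add hz0]
  have hs0 : 0 < z ^ (-b) := Real.rpow_pos_of_pos hz0 _
  have hm : 0 < z ^ (-a₁) := Real.rpow_pos_of_pos hz0 _
  have hn : 0 < z ^ (-a₂) := Real.rpow_pos_of_pos hz0 _
  have hp0 : 0 < a₁ / (a₁ + a₂) := by positivity
  have hp1 : a₂ / (a₂ + a₁) = 1 - a₁ / (a₁ + a₂) := by field_simp; ring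
  rw [hp1] at hI
  have hp2 : a₁ / (a₁ + a₂) ≤ 1 := by rw [div_le_one (by positivity)]; linarith
  generalize a₁ / (a₁ + a₂) = p at *
  generalize z ^ (-b) = s at *
  generalize z ^ (-a₁) = m at *
  generalize z ^ (-a₂) = l at *
  generalize μ.real (Set.Ioi z) = f at *
  generalize ν.real (Set.Ioi z) = g at *
  generalize (∫ x in Set.Ioi z, x ^ (-a₂) ∂μ) = I at *
  generalize (μ.prod ν).real (uncensSet z) = U at *
  have hss : s * s ≤ s := by nlinarith
  have hml : 0 < m * l := by positivity
  constructor
  · have d₁ : |f - C₁ * m| ≤ K₁ * m * s := abs_le.2 e₁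
    have d₂ : |g - C₂ * l| ≤ K₂ * l * s := abs_le.2 e₂
    have hsplit : f * g - C₁ * C₂ * (m * l) =
        (f - C₁ * m) * (g - C₂ * l) + (f - C₁ * m) * (C₂ * l) + C₁ * m * (g - C₂ * l) := by ring
    rw [hsplit]
    refine (abs_add_three _ _ _).trans ?_
    rw [abs_mul (f - _), abs_mul (f - _), abs_mul (C₁ * m), abs_of_pos (show 0 < C₂ * l by positivity),
      abs_of_pos (show 0 < C₁ * m by positivity)]
    calc |f - C₁ * m| * |g - C₂ * l| + |f - C₁ * m| * (C₂ * l) + C₁ * m * |g - C₂ * l|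
        ≤ K₁ * m * s * (K₂ * l * s) + K₁ * m * s * (C₂ * l) + C₁ * m * (K₂ * l * s) := by gcongr
      _ = (C₁ * K₂ * s + C₂ * K₁ * s + K₁ * K₂ * (s * s)) * (m * l) := by ring
      _ ≤ (C₁ * K₂ * s + 2 * (C₂ * K₁) * s + K₁ * K₂ * s) * (m * l) := by
          have : 0 < C₂ * K₁ * s := by positivity
          have h3 := mul_le_mul_of_nonneg_left hss (mul_pos hK₁ hK₂).le
          exact mul_le_mul_of_nonneg_right (by linarith) hml.le
      _ = _ := by ring
  · have hA0 : 0 < C₂ - K₂ * s := by linarith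
    have h3 : (C₁ * p - K₁ * s * (2 - p)) * (m * l) ≤ I := by
      have := mul_le_mul_of_nonneg_left e₁.1 hn.le
      nlinarith
    refine le_trans ?_ ((mul_le_mul_of_nonneg_left h3 hA0.le).trans hU)
    have hkey : p * (C₁ * C₂) - (C₁ * K₂ + 2 * (C₂ * K₁) + K₁ * K₂) * s ≤
        (C₂ - K₂ * s) * (C₁ * p - K₁ * s * (2 - p)) := by
      have t1 : 0 ≤ C₁ * K₂ * s * (1 - p) :=
        mul_nonneg (by positivity) (by linarith)
      have t2 : 0 ≤ C₂ * K₁ * s * p := by positivity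
      have t3 : 0 ≤ K₁ * K₂ * s * s * (2 - p) := mul_nonneg (by positivity) (by linarith)
      have t4 : 0 ≤ K₁ * K₂ * s := by positivity
      nlinarith
    have := mul_le_mul_of_nonneg_right hkey hml.le
    nlinarith

/-- There are levels `z(u)` above which an observation falls with probability about `u`, and
falls uncensored with probability at least about `p u`, both up to a relative error `u ^ c`. -/
theorem exists_level (μ ν : Measure ℝ) [IsProbabilityMeasure μ] [IsProbabilityMeasure ν]
    (hcont : Continuous (cdf μ)) {γ₁ γ₂ β₁ β₂ C₁ C₂ D₁ D₂ : ℝ}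
    (hγ₁ : 0 < γ₁) (hγ₂ : 0 < γ₂) (hβ₁ : 0 < β₁) (hβ₂ : 0 < β₂) (hC₁ : 0 < C₁) (hC₂ : 0 < C₂)
    (hF : HallTail (tail μ) γ₁ β₁ C₁ D₁) (hG : HallTail (tail ν) γ₂ β₂ C₂ D₂) :
    ∃ K c : ℝ, ∃ lev : ℝ → ℝ, 0 < K ∧ 0 < c ∧ c ≤ 1 ∧ ∀ᶠ u in 𝓝[>] 0,
      |(μ.prod ν).real (aboveSet (lev u)) - u| ≤ K * u * u ^ c ∧
      γ₂ / (γ₁ + γ₂) * u - K * u * u ^ c ≤ (μ.prod ν).real (uncensSet (lev u)) := by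
  have := nullSingletonClass_of_continuous_cdf μ hcont
  set a₁ := 1 / γ₁ with ha₁
  set a₂ := 1 / γ₂ with ha₂
  have ha₁0 : 0 < a₁ := by positivity
  have ha₂0 : 0 < a₂ := by positivity
  set b := min (a₁ + a₂) (min β₁ β₂) with hb
  have hb0 : 0 < b := lt_min (by positivity) (lt_min hβ₁ hβ₂)
  have hb1 : b ≤ a₁ + a₂ := min_le_left _ _
  obtain ⟨K₁, hK₁, h₁⟩ := hF.exists_abs_sub_le (b := b)
    ((min_le_right _ _).trans (min_le_left _ _))
  obtain ⟨K₂, hK₂, h₂⟩ := hG.exists_abs_sub_le (b := b)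
    ((min_le_right _ _).trans (min_le_right _ _))
  simp only [tail_eq_measureReal_Ioi, neg_div, ← ha₁, ← ha₂] at h₁ h₂
  obtain ⟨K, hK, hev⟩ := eventually_prod_tail_bounds μ ν ha₁0 ha₂0 hb0 hC₁ hC₂ hK₁ hK₂ h₁ h₂
  set a := a₁ + a₂ with ha
  have ha0 : 0 < a := by positivity
  set C := C₁ * C₂ with hC
  have hC0 : 0 < C := by positivity
  set c := b / a with hc
  have hc0 : 0 < c := by positivity
  have htend : Tendsto (fun u : ℝ => (C * u⁻¹) ^ (1 / a)) (𝓝[>] 0) atTop :=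
    (tendsto_rpow_atTop (by positivity)).comp
      (tendsto_inv_nhdsGT_zero.const_mul_atTop hC0)
  refine ⟨K / C / C ^ c, c, fun u => (C * u⁻¹) ^ (1 / a), by positivity, hc0,
    (div_le_one ha0).2 hb1, ?_⟩
  filter_upwards [htend.eventually hev, self_mem_nhdsWithin] with u hu hu0
  have hu0 : 0 < u := hu0
  have hCu : 0 < C * u⁻¹ := by positivity
  have hp : γ₂ / (γ₁ + γ₂) = a₁ / a := by
    rw [ha, ha₁, ha₂]
    field_simp
    ring
  have e1 : ((C * u⁻¹) ^ (1 / a)) ^ (-a) = u / C := by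
    rw [← Real.rpow_mul hCu.le, show 1 / a * -a = -1 by field_simp, Real.rpow_neg_one, mul_inv,
      inv_inv]
    ring
  have e2 : ((C * u⁻¹) ^ (1 / a)) ^ (-b) = u ^ c / C ^ c := by
    rw [← Real.rpow_mul hCu.le, show 1 / a * -b = -c by rw [hc]; ring, Real.rpow_neg hCu.le,
      Real.mul_rpow hC0.le (by positivity), Real.inv_rpow hu0.le, mul_inv, inv_inv]
    ring
  rw [e1, e2, mul_div_cancel₀ _ hC0.ne'] at hu
  rw [hp]
  have e3 : K * (u / C) * (u ^ c / C ^ c) = K / C / C ^ c * u * u ^ c := by ring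
  rw [e3] at hu
  exact hu

/-! ### Counting the observations in a set -/

/-- The number of points among the first `n` that lie in `B`. -/
noncomputable def count {E : Type*} (W : ℕ → Ω → E) (B : Set E) (n : ℕ) (ω : Ω) : ℝ :=
  ∑ i ∈ Finset.range n, B.indicator (fun _ => 1) (W i ω)

section Counting

variable {Ω : Type*} [MeasurableSpace Ω] {P : Measure Ω} {E : Type*} [MeasurableSpace E]
  {W : ℕ → Ω → E}

theorem integral_indicator_comp (hW : ∀ i, Measurable (W i))
    (hid : ∀ i, IdentDistrib (W i) (W 0) P P) {B : Set E} (hB : MeasurableSet B) (i : ℕ) :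
    ∫ ω, B.indicator (fun _ => (1 : ℝ)) (W i ω) ∂P = (P.map (W 0)).real B := by
  rw [← (hid i).map_eq, ← integral_map (hW i).aemeasurable
    (measurable_const.indicator hB).aestronglyMeasurable, integral_indicator hB]
  simp

variable [IsProbabilityMeasure P]

theorem integral_abs_sub_le_sqrt_variance {T : Ω → ℝ} (hT : MemLp T 2 P) :
    ∫ ω, |T ω - P[T]| ∂P ≤ √(Var[T; P]) := by
  refine Real.le_sqrt_of_sq_le ?_
  have hW : MemLp (fun ω => |T ω - P[T]|) 2 P := (hT.sub (memLp_const _)).norm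
  have h := variance_eq_sub hW
  have h0 := variance_nonneg (fun ω => |T ω - P[T]|) P
  rw [variance_eq_integral hT.aemeasurable]
  simp only [Pi.pow_apply, sq_abs] at h
  linarith

theorem memLp_indicator_comp (hW : ∀ i, Measurable (W i)) {B : Set E} (hB : MeasurableSet B)
    (i : ℕ) : MemLp (fun ω => B.indicator (fun _ => (1 : ℝ)) (W i ω)) 2 P := by
  refine MemLp.of_bound
    ((measurable_const.indicator hB).comp (hW i)).aestronglyMeasurable 1
    (Eventually.of_forall fun ω => ?_)
  by_cases h : W i ω ∈ B <;> simp [h]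

theorem memLp_count (hW : ∀ i, Measurable (W i)) {B : Set E} (hB : MeasurableSet B) (n : ℕ) :
    MemLp (count W B n) 2 P :=
  memLp_finsetSum _ fun i _ => memLp_indicator_comp hW hB i

theorem integral_count (hW : ∀ i, Measurable (W i))
    (hid : ∀ i, IdentDistrib (W i) (W 0) P P) {B : Set E} (hB : MeasurableSet B) (n : ℕ) :
    ∫ ω, count W B n ω ∂P = n * (P.map (W 0)).real B := by
  unfold count
  rw [integral_finsetSum _ fun i _ => (memLp_indicator_comp hW hB i).integrable (by norm_num)]
  simp [integral_indicator_comp hW hid hB]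

theorem variance_count_le (hW : ∀ i, Measurable (W i)) (hind : iIndepFun W P)
    (hid : ∀ i, IdentDistrib (W i) (W 0) P P) {B : Set E} (hB : MeasurableSet B) (n : ℕ) :
    Var[count W B n; P] ≤ n * (P.map (W 0)).real B := by
  have hsum : count W B n = ∑ i ∈ Finset.range n,
      fun ω => B.indicator (fun _ => (1 : ℝ)) (W i ω) := by
    ext ω
    simp [count]
  rw [hsum, IndepFun.variance_sum fun i _ => memLp_indicator_comp hW hB i]
  · refine (Finset.sum_le_card_nsmul _ _ ((P.map (W 0)).real B) fun i _ => ?_).trans (by simp)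
    rw [← integral_indicator_comp hW hid hB i]
    refine (variance_le_expectation_sq
      (memLp_indicator_comp hW hB i).aestronglyMeasurable).trans (le_of_eq ?_)
    refine integral_congr_ae (Eventually.of_forall fun ω => ?_)
    by_cases h : W i ω ∈ B <;> simp [h]
  · intro i _ j _ hij
    exact (hind.indepFun hij).comp (measurable_const.indicator hB) (measurable_const.indicator hB)

theorem integral_abs_count_sub_le (hW : ∀ i, Measurable (W i)) (hind : iIndepFun W P)
    (hid : ∀ i, IdentDistrib (W i) (W 0) P P) {B : Set E} (hB : MeasurableSet B) (n : ℕ) :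
    ∫ ω, |count W B n ω - n * (P.map (W 0)).real B| ∂P ≤ √(n * (P.map (W 0)).real B) := by
  have h := integral_abs_sub_le_sqrt_variance (memLp_count (P := P) hW hB n)
  rw [integral_count hW hid hB] at h
  exact h.trans (Real.sqrt_le_sqrt (variance_count_le hW hind hid hB n))

end Counting

/-! ### The counting error at the level of a given rank -/

theorem sum_above_obs {Ω : Type*} (X Y : ℕ → Ω → ℝ) (n : ℕ) (t : ℝ) (ω : Ω) :
    (∑ x, if t < obs X Y n ω x then (1 : ℝ) else 0) =
      count (fun i ω => (X i ω, Y i ω)) (aboveSet t) n ω := by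
  rw [count, Finset.sum_range]
  refine Finset.sum_congr rfl fun x _ => ?_
  simp [obs, aboveSet, Set.indicator_apply]

theorem sum_above_uncens {Ω : Type*} (X Y : ℕ → Ω → ℝ) (n : ℕ) (t : ℝ) (ω : Ω) :
    (∑ x, if t < obs X Y n ω x then uncens X Y n ω x else 0) =
      count (fun i ω => (X i ω, Y i ω)) (uncensSet t) n ω := by
  rw [count, Finset.sum_range]
  refine Finset.sum_congr rfl fun x _ => ?_
  by_cases h₁ : t < min (X x ω) (Y x ω) <;> by_cases h₂ : X x ω ≤ Y x ω <;>
    simp only [obs, uncens, uncensSet, Set.indicator_apply, Set.mem_ofPred_eq, h₁, h₂, and_self,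
      and_true, and_false, if_true, if_false]

section Sample

variable {Ω : Type*} [MeasurableSpace Ω] {P : Measure Ω} [IsProbabilityMeasure P] {X Y : ℕ → Ω → ℝ}

/-- Since `F` is continuous, almost surely an uncensored observation is not tied with any other
observation. -/
theorem ae_no_ties (hXm : ∀ i, Measurable (X i)) (hYm : ∀ i, Measurable (Y i))
    (hindep : iIndepFun (fun i ω => (X i ω, Y i ω)) P)
    (hident : ∀ i, IdentDistrib (fun ω => (X i ω, Y i ω)) (fun ω => (X 0 ω, Y 0 ω)) P P)
    (hFcont : Continuous (cdf (P.map (X 0)))) :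
    ∀ᵐ ω ∂P, ∀ i j, i ≠ j → X i ω ≠ min (X j ω) (Y j ω) := by
  have := Measure.isProbabilityMeasure_map (hXm 0).aemeasurable (μ := P)
  have := nullSingletonClass_of_continuous_cdf _ hFcont
  rw [ae_all_iff]
  intro i
  rw [ae_all_iff]
  intro j
  by_cases hij : i = j
  · exact Eventually.of_forall fun ω h => absurd hij h
  have hZm : Measurable fun ω => min (X j ω) (Y j ω) := (hXm j).min (hYm j)
  have hind : IndepFun (fun ω => min (X j ω) (Y j ω)) (X i) P :=
    (hindep.indepFun (Ne.symm hij)).comp (measurable_fst.min measurable_snd) measurable_fst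
  have hlaw : P.map (X i) = P.map (X 0) := ((hident i).comp measurable_fst).map_eq
  have hprod := (indepFun_iff_map_prod_eq_prod_map_map hZm.aemeasurable
    (hXm i).aemeasurable).1 hind
  rw [hlaw] at hprod
  have hdiag : MeasurableSet {q : ℝ × ℝ | q.1 = q.2} :=
    measurableSet_eq_fun measurable_fst measurable_snd
  have hnull : P.map (fun ω => (min (X j ω) (Y j ω), X i ω)) {q : ℝ × ℝ | q.1 = q.2} = 0 := by
    rw [hprod, Measure.measure_prod_null hdiag]
    refine Eventually.of_forall fun z => ?_
    have : Prod.mk z ⁻¹' {q : ℝ × ℝ | q.1 = q.2} = {z} := by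
      ext x
      simp [eq_comm]
    exact (congrArg (P.map (X 0)) this).trans (measure_singleton z)
  rw [Measure.map_apply (hZm.prodMk (hXm i)) hdiag] at hnull
  refine measure_mono_null (fun ω hω => ?_) hnull
  simp only [Set.mem_compl_iff, Set.mem_ofPred_eq, not_forall, not_not] at hω
  exact hω.2.symm

/-- Let `z` be the level exceeded by about `i` of the `n` observations. The error `e n i`
controls both the deviation of the number of observations above `z` from `i` and the shortfall of
uncensored ones below `p i`. In mean it is `O(√i + i (i / n) ^ c)`, with the square root
coming from the fluctuations and the second term from the second-order condition on the tails. -/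
theorem exists_counting_error (hXm : ∀ i, Measurable (X i)) (hYm : ∀ i, Measurable (Y i))
    (hindep : iIndepFun (fun i ω => (X i ω, Y i ω)) P)
    (hident : ∀ i, IdentDistrib (fun ω => (X i ω, Y i ω)) (fun ω => (X 0 ω, Y 0 ω)) P P)
    (hXY : IndepFun (X 0) (Y 0) P) (hFcont : Continuous (cdf (P.map (X 0))))
    {γ₁ γ₂ β₁ β₂ C₁ C₂ D₁ D₂ : ℝ}
    (hγ₁ : 0 < γ₁) (hγ₂ : 0 < γ₂) (hβ₁ : 0 < β₁) (hβ₂ : 0 < β₂) (hC₁ : 0 < C₁) (hC₂ : 0 < C₂)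
    (hF : HallTail (tail (P.map (X 0))) γ₁ β₁ C₁ D₁)
    (hG : HallTail (tail (P.map (Y 0))) γ₂ β₂ C₂ D₂) :
    ∃ K c θ : ℝ, ∃ lev : ℕ → ℕ → ℝ, ∃ e : ℕ → ℕ → Ω → ℝ, 0 < K ∧ 0 < c ∧ c ≤ 1 ∧ 0 < θ ∧
      ∀ n i : ℕ, 1 ≤ n → 1 ≤ i → (i : ℝ) / n ≤ θ →
        Integrable (e n i) P ∧
        ∫ ω, e n i ω ∂P ≤ K * (√i + i * ((i : ℝ) / n) ^ c) ∧
        ∀ ω, |(i : ℝ) - count (fun i ω => (X i ω, Y i ω)) (aboveSet (lev n i)) n ω| ≤ e n i ω ∧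
          γ₂ / (γ₁ + γ₂) * i - e n i ω ≤
            count (fun i ω => (X i ω, Y i ω)) (uncensSet (lev n i)) n ω -
              |(i : ℝ) - count (fun i ω => (X i ω, Y i ω)) (aboveSet (lev n i)) n ω| := by
  have := Measure.isProbabilityMeasure_map (hXm 0).aemeasurable (μ := P)
  have := Measure.isProbabilityMeasure_map (hYm 0).aemeasurable (μ := P)
  obtain ⟨K, c, lev, hK, hc, hc1, hlev⟩ := exists_level (P.map (X 0)) (P.map (Y 0)) hFcont hγ₁ hγ₂
    hβ₁ hβ₂ hC₁ hC₂ hF hG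
  rw [← (indepFun_iff_map_prod_eq_prod_map_map (hXm 0).aemeasurable (hYm 0).aemeasurable).1 hXY]
    at hlev
  obtain ⟨θ, hθ, hlevθ⟩ := mem_nhdsGT_iff_exists_Ioc_subset.1 hlev
  have hθ : 0 < θ := hθ
  set W : ℕ → Ω → ℝ × ℝ := fun i ω => (X i ω, Y i ω) with hWdef
  have hW : ∀ i, Measurable (W i) := fun i => (hXm i).prodMk (hYm i)
  have := Measure.isProbabilityMeasure_map (hW 0).aemeasurable (μ := P)
  set π := P.map (W 0) with hπ
  refine ⟨2 * K + 2 * √(1 + K), c, min θ 1, fun n i => lev (i / n),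
    fun n i ω => |(i : ℝ) - count W (aboveSet (lev (i / n))) n ω| +
      |count W (uncensSet (lev (i / n))) n ω - n * π.real (uncensSet (lev (i / n)))| +
      K * i * ((i : ℝ) / n) ^ c, by positivity, hc, hc1, lt_min hθ one_pos, ?_⟩
  intro n i hn hi hin
  have hn0 : (0 : ℝ) < n := by exact_mod_cast hn
  have hi0 : (0 : ℝ) < i := by exact_mod_cast hi
  obtain ⟨hab, hun⟩ : |π.real (aboveSet (lev (i / n))) - (i : ℝ) / n| ≤
      K * ((i : ℝ) / n) * ((i : ℝ) / n) ^ c ∧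
      γ₂ / (γ₁ + γ₂) * ((i : ℝ) / n) - K * ((i : ℝ) / n) * ((i : ℝ) / n) ^ c ≤
        π.real (uncensSet (lev (i / n))) :=
    hlevθ ⟨by positivity, hin.trans (min_le_left _ _)⟩
  set z := lev (i / n) with hz
  set u : ℝ := (i : ℝ) / n with hu
  have hu0 : 0 < u := by positivity
  have hun1 : (n : ℝ) * u = i := by rw [hu]; field_simp
  have huc : u ^ c ≤ 1 := Real.rpow_le_one hu0.le (hin.trans (min_le_right _ _)) hc.le
  have huc0 : 0 < u ^ c := Real.rpow_pos_of_pos hu0 _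
  -- multiply the two bounds on the probabilities by `n`
  have hab' : |(i : ℝ) - n * π.real (aboveSet z)| ≤ K * i * u ^ c := by
    rw [← hun1, ← mul_sub, abs_mul, abs_of_pos hn0, abs_sub_comm]
    calc (n : ℝ) * |π.real (aboveSet z) - u| ≤ n * (K * u * u ^ c) := by gcongr
      _ = _ := by ring
  have hun' : γ₂ / (γ₁ + γ₂) * i - K * i * u ^ c ≤ n * π.real (uncensSet z) := by
    calc γ₂ / (γ₁ + γ₂) * i - K * i * u ^ c
        = n * (γ₂ / (γ₁ + γ₂) * u - K * u * u ^ c) := by rw [← hun1]; ring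
      _ ≤ _ := by gcongr
  have hI₀ : Integrable (count W (aboveSet z) n) P :=
    (memLp_count hW (measurableSet_aboveSet z) n).integrable (by norm_num)
  have hI₁ : Integrable (count W (uncensSet z) n) P :=
    (memLp_count hW (measurableSet_uncensSet z) n).integrable (by norm_num)
  have hJ₀ : Integrable (fun ω => |(i : ℝ) - count W (aboveSet z) n ω|) P :=
    ((integrable_const _).sub hI₀).abs
  have hJ₁ : Integrable
      (fun ω => |count W (uncensSet z) n ω - n * π.real (uncensSet z)|) P :=
    (hI₁.sub (integrable_const _)).abs
  have hJ₂ : Integrable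
      (fun ω => |count W (aboveSet z) n ω - n * π.real (aboveSet z)|) P :=
    (hI₀.sub (integrable_const _)).abs
  refine ⟨(hJ₀.add hJ₁).add (integrable_const _), ?_, fun ω => ⟨?_, ?_⟩⟩
  · have hsum : ∫ ω, (|(i : ℝ) - count W (aboveSet z) n ω| +
        |count W (uncensSet z) n ω - n * π.real (uncensSet z)| + K * i * u ^ c) ∂P =
        ∫ ω, |(i : ℝ) - count W (aboveSet z) n ω| ∂P +
        ∫ ω, |count W (uncensSet z) n ω - n * π.real (uncensSet z)| ∂P + K * i * u ^ c := by
      rw [integral_add (f := fun ω => |(i : ℝ) - count W (aboveSet z) n ω| +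
          |count W (uncensSet z) n ω - n * π.real (uncensSet z)|) (hJ₀.add hJ₁)
        (integrable_const _), integral_add hJ₀ hJ₁]
      simp
    refine hsum.trans_le ?_
    have hle : n * π.real (aboveSet z) ≤ (1 + K) * i := by
      have h1 := (abs_le.1 hab').1
      have h2 : K * i * u ^ c ≤ K * i * 1 := by gcongr
      linarith
    have hmono : (n : ℝ) * π.real (uncensSet z) ≤ (1 + K) * i :=
      (mul_le_mul_of_nonneg_left (measureReal_mono (uncensSet_subset z)) hn0.le).trans hle
    have hs : ∀ r : ℝ, r ≤ (1 + K) * i → √r ≤ √(1 + K) * √i := fun r hr => by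
      rw [← Real.sqrt_mul (by positivity)]
      exact Real.sqrt_le_sqrt hr
    have h₁ := (integral_abs_count_sub_le hW hindep hident (measurableSet_uncensSet z) n).trans
      (hs _ hmono)
    have h₂ := (integral_abs_count_sub_le hW hindep hident (measurableSet_aboveSet z) n).trans
      (hs _ hle)
    have h₃ : ∫ ω, |(i : ℝ) - count W (aboveSet z) n ω| ∂P ≤
        K * i * u ^ c + √(1 + K) * √i := by
      calc ∫ ω, |(i : ℝ) - count W (aboveSet z) n ω| ∂P
          ≤ ∫ ω, (K * i * u ^ c + |count W (aboveSet z) n ω - n * π.real (aboveSet z)|) ∂P := by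
            refine integral_mono hJ₀ ((integrable_const _).add hJ₂) fun ω => ?_
            have := abs_sub_le (i : ℝ) (n * π.real (aboveSet z)) (count W (aboveSet z) n ω)
            rw [abs_sub_comm (n * π.real (aboveSet z))] at this
            show _ ≤ K * i * u ^ c + _
            linarith
        _ = K * i * u ^ c + ∫ ω, |count W (aboveSet z) n ω - n * π.real (aboveSet z)| ∂P := by
            rw [integral_add (integrable_const _) hJ₂]
            simp
        _ ≤ _ := by gcongr
    calc _ ≤ K * i * u ^ c + √(1 + K) * √i + √(1 + K) * √i + K * i * u ^ c := by gcongr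
      _ = 2 * K * (i * u ^ c) + 2 * √(1 + K) * √i := by ring
      _ ≤ 2 * K * (i * u ^ c) + 2 * √(1 + K) * √i + (2 * K * √i + 2 * √(1 + K) * (i * u ^ c)) :=
          le_add_of_nonneg_right (by positivity)
      _ = _ := by ring
  · have : 0 ≤ K * i * u ^ c := by positivity
    have := abs_nonneg (count W (uncensSet z) n ω - n * π.real (uncensSet z))
    linarith
  · have := neg_abs_le (count W (uncensSet z) n ω - n * π.real (uncensSet z))
    linarith

end Sample

/-! ### Uniform summability of the error bounds -/

/-- The bounds `√i` and `i (i / n) ^ c` on the errors are summable against the weights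
`1 / (i (i + 1))` over `i ≤ k`, uniformly in `k ≤ n`: both sums telescope. -/
theorem sum_error_weights_le {c : ℝ} (hc : 0 < c) (hc1 : c ≤ 1) {k n : ℕ} (hn : 1 ≤ n)
    (hkn : k ≤ n) :
    ∑ i ∈ Finset.range k, (√((i + 1 : ℕ) : ℝ) +
        ((i + 1 : ℕ) : ℝ) * (((i + 1 : ℕ) : ℝ) / n) ^ c) / (((i : ℝ) + 1) * (i + 2)) ≤
      2 + 1 / c := by
  have hn0 : (0 : ℝ) < n := by exact_mod_cast hn
  have key : ∀ k : ℕ, ∑ i ∈ Finset.range k, (√((i + 1 : ℕ) : ℝ) +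
        ((i + 1 : ℕ) : ℝ) * (((i + 1 : ℕ) : ℝ) / n) ^ c) / (((i : ℝ) + 1) * (i + 2)) ≤
      2 - 2 / √((k : ℝ) + 1) + 1 / c * ((k : ℝ) / n) ^ c := by
    intro k
    induction k with
    | zero => simp [hc.ne']
    | succ k ih =>
      rw [Finset.sum_range_succ, add_div]
      have h1 : √((k + 1 : ℕ) : ℝ) / (((k : ℝ) + 1) * (k + 2)) ≤
          2 / √((k : ℝ) + 1) - 2 / √((k : ℝ) + 1 + 1) := by
        have hr2 : √((k : ℝ) + 1 + 1) ^ 2 = k + 2 := by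
          rw [Real.sq_sqrt (by positivity)]
          ring
        have hs2 : √((k : ℝ) + 1) ^ 2 = k + 1 := Real.sq_sqrt (by positivity)
        have hsr : √((k : ℝ) + 1) ≤ √((k : ℝ) + 1 + 1) := Real.sqrt_le_sqrt (by linarith)
        have hs0 : 0 < √((k : ℝ) + 1) := Real.sqrt_pos.2 (by positivity)
        push_cast
        generalize √((k : ℝ) + 1) = s at *
        generalize √((k : ℝ) + 1 + 1) = r at *
        have hd : r ^ 2 - s ^ 2 = 1 := by rw [hr2, hs2]; ring
        rw [← hr2, ← hs2]
        have hr0 : 0 < r := hs0.trans_le hsr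
        rw [div_sub_div _ _ hs0.ne' hr0.ne', div_le_div_iff₀ (by positivity) (by positivity)]
        have hd' : (r - s) * (r + s) = 1 := by linarith
        have hrs : 0 ≤ r - s := by linarith
        have h3 : 1 ≤ 2 * r * (r - s) := by nlinarith
        have h4 : 0 ≤ s ^ 2 * r := by positivity
        nlinarith [mul_le_mul_of_nonneg_left h3 h4]
      have h2 : ((k + 1 : ℕ) : ℝ) * (((k + 1 : ℕ) : ℝ) / n) ^ c / (((k : ℝ) + 1) * (k + 2)) ≤
          1 / c * (((k + 1 : ℕ) : ℝ) / n) ^ c - 1 / c * ((k : ℝ) / n) ^ c := by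
        have hk1 : (0 : ℝ) < (k : ℝ) + 1 := by positivity
        have hinv : 1 / ((k : ℝ) + 1) ≤ 1 := by
          rw [div_le_one hk1]
          linarith [(Nat.cast_nonneg k : (0 : ℝ) ≤ k)]
        have hbern : (1 + -(1 / ((k : ℝ) + 1))) ^ c ≤ 1 + c * -(1 / ((k : ℝ) + 1)) :=
          rpow_one_add_le_one_add_mul_self (by linarith) hc.le hc1
        have hsplit : ((k : ℝ) / n) ^ c =
            (((k : ℝ) + 1) / n) ^ c * (1 + -(1 / ((k : ℝ) + 1))) ^ c := by
          rw [← Real.mul_rpow (by positivity) (by linarith)]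
          congr 1
          field_simp
          ring
        push_cast
        rw [hsplit]
        have hv0 : 0 ≤ (((k : ℝ) + 1) / n) ^ c := by positivity
        generalize (((k : ℝ) + 1) / n) ^ c = v at *
        have h3 := mul_le_mul_of_nonneg_left hbern hv0
        calc ((k : ℝ) + 1) * v / (((k : ℝ) + 1) * (k + 2)) = v / (k + 2) := by field_simp
          _ ≤ v / (k + 1) := by gcongr; linarith
          _ = 1 / c * v - 1 / c * (v * (1 + c * -(1 / ((k : ℝ) + 1)))) := by field_simp; ring
          _ ≤ _ := by gcongr
      push_cast at h1 h2 ih ⊢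
      linarith
  refine (key k).trans ?_
  have h1 : ((k : ℝ) / n) ^ c ≤ 1 :=
    Real.rpow_le_one (by positivity) ((div_le_one hn0).2 (by exact_mod_cast hkn)) hc.le
  have h2 : 1 / c * ((k : ℝ) / n) ^ c ≤ 1 / c * 1 := by gcongr
  have h3 : 0 ≤ 2 / √((k : ℝ) + 1) := by positivity
  linarith

/-! ### The bound in probability -/

/-- The bound on a good event: `e i` are the errors of the counts at the levels `lev i`, with a
weighted sum at most `R`, and the level `lev L` is exceeded at least once and fewer than `2 L`
times because its own error is below `L`. -/
theorem abs_maxIncrement_le {Ω : Type*} {X Y : ℕ → Ω → ℝ} {ω : Ω} {n k L : ℕ} {p R : ℝ}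
    {lev e : ℕ → ℝ} (hk : 1 ≤ k) (hkn : k < n) (hp : 0 ≤ p)
    (hties : ∀ i j, i ≠ j → X i ω ≠ min (X j ω) (Y j ω))
    (hlow : ∀ i, 1 ≤ i → i ≤ k →
      p * i - e i ≤ count (fun i ω => (X i ω, Y i ω)) (uncensSet (lev i)) n ω -
        |(i : ℝ) - count (fun i ω => (X i ω, Y i ω)) (aboveSet (lev i)) n ω|)
    (hR : e k / ((k : ℝ) + 1) + ∑ i ∈ Finset.range k, e (i + 1) / (((i : ℝ) + 1) * (i + 2)) ≤ R)
    (hL : |(L : ℝ) - count (fun i ω => (X i ω, Y i ω)) (aboveSet (lev L)) n ω| < L) :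
    |maxIncrement X Y k n ω| ≤ 2 * L * Real.exp (R + 1) * (k : ℝ) ^ (-p) := by
  set z := obs X Y n ω
  set d := uncens X Y n ω
  have hd₀ : ∀ x, 0 ≤ d x := fun x => by
    simp only [d, uncens]
    split_ifs <;> norm_num
  have hd₁ : ∀ x, d x ≤ 1 := fun x => by
    simp only [d, uncens]
    split_ifs <;> norm_num
  have htied : ∀ x y, x ≠ y → z x = z y → d x = 0 := by
    intro x y hxy hz
    simp only [d, uncens]
    refine if_neg fun hle => hties x y (by simpa [Fin.ext_iff] using hxy) ?_
    simpa [z, obs, hle] using hz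
  have hk0 : (0 : ℝ) < k := by exact_mod_cast hk
  -- the level `lev L` lies below the maximum and has fewer than `2 L` observations above it
  rw [← sum_above_obs] at hL
  have hL' := abs_lt.1 hL
  have hone : 1 ≤ ∑ x, if lev L < z x then (1 : ℝ) else 0 := by
    have hpos : 0 < ∑ x, if lev L < z x then (1 : ℝ) else 0 := by linarith
    rw [Finset.sum_boole] at hpos ⊢
    exact_mod_cast hpos
  have htwo : (∑ x, if lev L < z x then (1 : ℝ) else 0) ≤ 2 * L := by linarith
  have hsum : p * Real.log k - R ≤
      ∑ l ∈ Finset.range k, concomitant z d (n - l) / ((l : ℝ) + 1) := by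
    have := le_sum_div_succ (w := fun l => concomitant z d (n - l)) (e := e) hp hk
      fun i hi hik => by
        have h1 := sum_above_sub_le_sum_top z hd₀ hd₁ (lev i) (hik.trans hkn.le)
        rw [sum_above_uncens, sum_above_obs] at h1
        exact (hlow i hi hik).trans h1
    linarith
  rw [Finset.range_eq_Ico, Finset.sum_eq_sum_Ico_succ_bot (by omega)] at hsum
  have htop := concomitant_le_one z hd₁ (n - 0)
  have hratio : kmProd z d 1 / kmProd z d k ≤ Real.exp (R + 1) * (k : ℝ) ^ (-p) := by
    have h1 := kmProd_one_le z hd₁ hk hkn.le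
    rw [mul_comm, ← div_le_iff₀ (kmProd_pos z hd₁ hk)] at h1
    refine h1.trans ?_
    rw [Real.rpow_def_of_pos hk0, ← Real.exp_add]
    refine Real.exp_le_exp.2 ?_
    simp only [Nat.cast_zero, zero_add, div_one] at hsum
    linarith
  have hbound : ∀ j : Fin k, |kmIncrement z d k (j + 1)| ≤
      2 * L * Real.exp (R + 1) * (k : ℝ) ^ (-p) := fun j => by
    refine (abs_kmIncrement_le hd₀ hd₁ htied hone htwo hkn (by omega) (by omega)).trans ?_
    rw [mul_assoc (2 * (L : ℝ))]
    gcongr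
  unfold maxIncrement
  rw [abs_of_nonneg (Real.iSup_nonneg fun _ => abs_nonneg _)]
  exact Real.iSup_le hbound (by positivity)

/-- Markov's inequality, with the bound on the mean given relative to the threshold. -/
theorem measure_ge_le_of_integral_le {Ω : Type*} [MeasurableSpace Ω] {P : Measure Ω}
    [IsProbabilityMeasure P] {f : Ω → ℝ} (hf : Integrable f P) (h0 : ∀ ω, 0 ≤ f ω) {a η : ℝ}
    (ha : 0 < a) (h : ∫ ω, f ω ∂P ≤ η * a) : P {ω | a ≤ f ω} ≤ ENNReal.ofReal η := by
  rw [← ENNReal.ofReal_toReal (measure_ne_top P _)]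
  refine ENNReal.ofReal_le_ofReal ?_
  have h1 := mul_meas_ge_le_integral_of_nonneg (Eventually.of_forall h0) hf a
  have h2 : a * (P {ω | a ≤ f ω}).toReal ≤ a * η := by
    rw [mul_comm a η]
    exact h1.trans h
  exact le_of_mul_le_mul_left h2 ha

theorem isBigOInProbability_maxIncrement {Ω : Type*} [MeasurableSpace Ω] (P : Measure Ω)
    [IsProbabilityMeasure P] {X Y : ℕ → Ω → ℝ}
    (hXm : ∀ i, Measurable (X i)) (hYm : ∀ i, Measurable (Y i))
    (hindep : iIndepFun (fun i ω => (X i ω, Y i ω)) P)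
    (hident : ∀ i, IdentDistrib (fun ω => (X i ω, Y i ω)) (fun ω => (X 0 ω, Y 0 ω)) P P)
    (hXY : IndepFun (X 0) (Y 0) P) (hFcont : Continuous (cdf (P.map (X 0))))
    {γ₁ γ₂ β₁ β₂ C₁ C₂ D₁ D₂ : ℝ}
    (hγ₁ : 0 < γ₁) (hγ₂ : 0 < γ₂) (hβ₁ : 0 < β₁) (hβ₂ : 0 < β₂) (hC₁ : 0 < C₁) (hC₂ : 0 < C₂)
    (hF : HallTail (tail (P.map (X 0))) γ₁ β₁ C₁ D₁)
    (hG : HallTail (tail (P.map (Y 0))) γ₂ β₂ C₂ D₂)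
    {k : ℕ → ℕ} (hk : ∀ᶠ n in atTop, 1 < k n ∧ k n < n)
    (hkn : Tendsto (fun n => (k n : ℝ) / n) atTop (𝓝 0)) :
    IsBigOInProbability P (fun n => maxIncrement X Y (k n) n)
      (fun n => (k n : ℝ) ^ (-(γ₂ / (γ₁ + γ₂)))) := by
  obtain ⟨K, c, θ, lev, e, hK, hc, hc1, hθ, he⟩ := exists_counting_error hXm hYm hindep hident hXY
    hFcont hγ₁ hγ₂ hβ₁ hβ₂ hC₁ hC₂ hF hG
  intro η hη
  set B := 2 * K + K * (2 + 1 / c) with hB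
  have hB0 : 0 < B := by positivity
  set R := B / (η / 2) with hRdef
  have hR0 : 0 < R := by positivity
  -- a rank `L` whose mean relative error `K / √L` is small
  obtain ⟨L, hL1, hLη⟩ : ∃ L : ℕ, 1 ≤ L ∧ K / √L < η / 4 := by
    have h1 : Tendsto (fun L : ℕ => K / √(L : ℝ)) atTop (𝓝 0) :=
      tendsto_const_nhds.div_atTop (Real.tendsto_sqrt_atTop.comp tendsto_natCast_atTop_atTop)
    exact ((eventually_ge_atTop 1).and
      ((tendsto_order.1 h1).2 (η / 4) (by positivity))).exists
  have hL0 : (0 : ℝ) < L := by exact_mod_cast hL1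
  refine ⟨2 * L * Real.exp (R + 1), by positivity, ?_⟩
  have hLn : Tendsto (fun n : ℕ => (L : ℝ) / n) atTop (𝓝 0) :=
    tendsto_const_nhds.div_atTop tendsto_natCast_atTop_atTop
  have hLnc : Tendsto (fun n : ℕ => K * ((L : ℝ) / n) ^ c) atTop (𝓝 0) := by
    have := (hLn.rpow_const (p := c) (Or.inr hc.le)).const_mul K
    rwa [Real.zero_rpow hc.ne', mul_zero] at this
  filter_upwards [hk, (tendsto_order.1 hkn).2 θ hθ, (tendsto_order.1 hLn).2 θ hθ,
    (tendsto_order.1 hLnc).2 (η / 4) (by positivity)] with n hkn hkθ hLθ hLc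
  obtain ⟨hk1, hkn⟩ := hkn
  have hn0 : (0 : ℝ) < n := by exact_mod_cast (show 0 < n by omega)
  have hk0 : (0 : ℝ) < k n := by exact_mod_cast (show 0 < k n by omega)
  have hei : ∀ i : ℕ, 1 ≤ i → i ≤ k n → (i : ℝ) / n ≤ θ := fun i _ hi =>
    (div_le_div_of_nonneg_right (by exact_mod_cast hi) hn0.le).trans hkθ.le
  set T : Ω → ℝ := fun ω => e n (k n) ω / ((k n : ℝ) + 1) +
    ∑ i ∈ Finset.range (k n), e n (i + 1) ω / (((i : ℝ) + 1) * (i + 2)) with hT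
  have hnonneg : ∀ i : ℕ, 1 ≤ i → (i : ℝ) / n ≤ θ → ∀ ω, 0 ≤ e n i ω := fun i hi hin ω =>
    (abs_nonneg _).trans ((he n i (by omega) hi hin).2.2 ω).1
  have hlast := he n (k n) (by omega) (by omega) hkθ.le
  have hterm : ∀ i ∈ Finset.range (k n), (((i + 1 : ℕ) : ℝ) / n ≤ θ) := fun i hi =>
    hei (i + 1) (by omega) (by have := Finset.mem_range.1 hi; omega)
  have hTint' : ∀ i ∈ Finset.range (k n),
      Integrable (fun ω => e n (i + 1) ω / (((i : ℝ) + 1) * (i + 2))) P := fun i hi =>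
    (he n (i + 1) (by omega) (by omega) (hterm i hi)).1.div_const _
  have hTint : Integrable T P :=
    (hlast.1.div_const _).add (integrable_finsetSum _ hTint')
  have hT0 : ∀ ω, 0 ≤ T ω := fun ω =>
    add_nonneg (div_nonneg (hnonneg _ (by omega) hkθ.le ω) (by positivity))
      (Finset.sum_nonneg fun i hi =>
        div_nonneg (hnonneg _ (by omega) (hterm i hi) ω) (by positivity))
  have hTB : ∫ ω, T ω ∂P ≤ B := by
    rw [hT, integral_add (hlast.1.div_const _) (integrable_finsetSum _ hTint'),
      integral_finsetSum _ hTint', integral_div]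
    refine add_le_add ?_ ?_
    · rw [div_le_iff₀ (by positivity)]
      refine hlast.2.1.trans ?_
      have h1 : √(k n : ℝ) ≤ k n := by
        rw [Real.sqrt_le_left hk0.le]
        have : (1 : ℝ) ≤ k n := by exact_mod_cast hk1.le
        nlinarith
      have h2 : ((k n : ℝ) / n) ^ c ≤ 1 := Real.rpow_le_one (by positivity)
        ((div_le_one hn0).2 (by exact_mod_cast hkn.le)) hc.le
      calc K * (√(k n : ℝ) + k n * ((k n : ℝ) / n) ^ c)
          ≤ K * (k n + k n * 1) := by gcongr
        _ ≤ 2 * K * ((k n : ℝ) + 1) := by linarith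
    · calc ∑ i ∈ Finset.range (k n), ∫ ω, e n (i + 1) ω / (((i : ℝ) + 1) * (i + 2)) ∂P
          ≤ ∑ i ∈ Finset.range (k n), K * ((√((i + 1 : ℕ) : ℝ) +
            ((i + 1 : ℕ) : ℝ) * (((i + 1 : ℕ) : ℝ) / n) ^ c) / (((i : ℝ) + 1) * (i + 2))) := by
            refine Finset.sum_le_sum fun i hi => ?_
            rw [integral_div, mul_div_assoc']
            exact div_le_div_of_nonneg_right
              (he n (i + 1) (by omega) (by omega) (hterm i hi)).2.1 (by positivity)
        _ ≤ K * (2 + 1 / c) := by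
            rw [← Finset.mul_sum]
            exact mul_le_mul_of_nonneg_left
              (sum_error_weights_le hc hc1 (by omega) hkn.le) hK.le
  have heL := he n L (by omega) hL1 hLθ.le
  have hP₁ : P {ω | R ≤ T ω} ≤ ENNReal.ofReal (η / 2) :=
    measure_ge_le_of_integral_le hTint hT0 hR0 (hTB.trans (le_of_eq (by rw [hRdef]; field_simp)))
  have hP₂ : P {ω | (L : ℝ) ≤ e n L ω} ≤ ENNReal.ofReal (η / 2) := by
    refine measure_ge_le_of_integral_le heL.1 (hnonneg L hL1 hLθ.le) hL0 (heL.2.1.trans ?_)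
    have hsq : √(L : ℝ) = 1 / √(L : ℝ) * L := by
      rw [one_div, inv_mul_eq_div, Real.div_sqrt]
    calc K * (√(L : ℝ) + L * ((L : ℝ) / n) ^ c)
        = (K / √(L : ℝ) + K * ((L : ℝ) / n) ^ c) * L := by
          conv_lhs => rw [hsq]
          ring
      _ ≤ (η / 4 + η / 4) * L := by gcongr
      _ = η / 2 * L := by ring
  calc P {ω | 2 * L * Real.exp (R + 1) * |(k n : ℝ) ^ (-(γ₂ / (γ₁ + γ₂)))| <
        |maxIncrement X Y (k n) n ω|}
      ≤ P ({ω | R ≤ T ω} ∪ {ω | (L : ℝ) ≤ e n L ω}) := by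
        refine measure_mono_ae ?_
        filter_upwards [ae_no_ties hXm hYm hindep hident hFcont] with ω hties hω
        by_contra hcon
        have hcon : ¬ (R ≤ T ω ∨ (L : ℝ) ≤ e n L ω) := hcon
        have hω : 2 * L * Real.exp (R + 1) * |(k n : ℝ) ^ (-(γ₂ / (γ₁ + γ₂)))| <
          |maxIncrement X Y (k n) n ω| := hω
        push Not at hcon
        rw [abs_of_pos (Real.rpow_pos_of_pos hk0 _)] at hω
        refine hω.not_ge (abs_maxIncrement_le (lev := lev n) (e := fun i => e n i ω) (by omega)
          hkn (by positivity) hties (fun i hi hik => ?_) hcon.1.le ?_)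
        · exact ((he n i (by omega) hi (hei i hi hik)).2.2 ω).2
        · exact ((heL.2.2 ω).1).trans_lt hcon.2
    _ ≤ ENNReal.ofReal (η / 2) + ENNReal.ofReal (η / 2) :=
        (measure_union_le _ _).trans (add_le_add hP₁ hP₂)
    _ = ENNReal.ofReal η := by
        rw [← ENNReal.ofReal_add (by positivity) (by positivity), add_halves]

theorem IsBigOInProbability.tendstoInMeasure {Ω : Type*} [MeasurableSpace Ω] {P : Measure Ω}
    {ξ : ℕ → Ω → ℝ} {a : ℕ → ℝ} (h : IsBigOInProbability P ξ a) (ha : Tendsto a atTop (𝓝 0)) :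
    TendstoInMeasure P ξ atTop (fun _ => 0) := by
  rw [tendstoInMeasure_iff_norm]
  intro ε hε
  rw [ENNReal.tendsto_nhds_zero]
  intro δ hδ
  obtain ⟨η, hη0, hηδ⟩ : ∃ η : ℝ, 0 < η ∧ ENNReal.ofReal η ≤ δ := by
    obtain ⟨r, hr0, hrδ⟩ := ENNReal.lt_iff_exists_nnreal_btwn.1 hδ
    exact ⟨r, by exact_mod_cast hr0, by simpa using hrδ.le⟩
  obtain ⟨M, hM, hev⟩ := h η hη0
  have hMa : Tendsto (fun n => M * |a n|) atTop (𝓝 0) := by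
    simpa using ha.abs.const_mul M
  filter_upwards [hev, (tendsto_order.1 hMa).2 ε hε] with n hn hlt
  refine (measure_mono fun ω hω => ?_).trans (hn.trans hηδ)
  have hω : ε ≤ ‖ξ n ω - 0‖ := hω
  rw [sub_zero, Real.norm_eq_abs] at hω
  exact hlt.trans_le hω

end CensoredTail

theorem proposition2 {Ω : Type*} [MeasurableSpace Ω] (P : Measure Ω) [IsProbabilityMeasure P]
    (X Y : ℕ → Ω → ℝ)
    (hXm : ∀ i, Measurable (X i)) (hYm : ∀ i, Measurable (Y i))
    (hX0 : ∀ i, ∀ᵐ ω ∂P, 0 ≤ X i ω) (hY0 : ∀ i, ∀ᵐ ω ∂P, 0 ≤ Y i ω)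
    (hindep : iIndepFun (fun i ω => (X i ω, Y i ω)) P)
    (hident : ∀ i, IdentDistrib (fun ω => (X i ω, Y i ω)) (fun ω => (X 0 ω, Y 0 ω)) P P)
    (hXY : IndepFun (X 0) (Y 0) P)
    (hFcont : Continuous (cdf (P.map (X 0))))
    (γ₁ γ₂ β₁ β₂ C₁ C₂ D₁ D₂ : ℝ)
    (hγ₁ : 0 < γ₁) (hγ₂ : 0 < γ₂) (hβ₁ : 0 < β₁) (hβ₂ : 0 < β₂) (hC₁ : 0 < C₁) (hC₂ : 0 < C₂)
    (hF : CensoredTail.HallTail (CensoredTail.tail (P.map (X 0))) γ₁ β₁ C₁ D₁)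
    (hG : CensoredTail.HallTail (CensoredTail.tail (P.map (Y 0))) γ₂ β₂ C₂ D₂)
    (p : ℝ) (hp : p = γ₂ / (γ₁ + γ₂))
    (k : ℕ → ℕ) (hk : ∀ᶠ n in atTop, 1 < k n ∧ k n < n)
    (hkinf : Tendsto k atTop atTop)
    (hkn : Tendsto (fun n => (k n : ℝ) / n) atTop (𝓝 0)) :
    CensoredTail.IsBigOInProbability P (fun n => CensoredTail.maxIncrement X Y (k n) n)
        (fun n => (k n : ℝ) ^ (-p)) ∧
      TendstoInMeasure P (fun n => CensoredTail.maxIncrement X Y (k n) n) atTop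
        (fun _ => 0) := by
  subst hp
  have hO := CensoredTail.isBigOInProbability_maxIncrement P hXm hYm hindep hident hXY hFcont
    hγ₁ hγ₂ hβ₁ hβ₂ hC₁ hC₂ hF hG hk hkn
  exact ⟨hO, hO.tendstoInMeasure ((tendsto_rpow_neg_atTop (by positivity)).comp
    (tendsto_natCast_atTop_atTop.comp hkinf))⟩
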